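/- **Setting.** Let $Q$ be a finite-dimensional smooth manifold, $\pi_Q:T^*Q\to Q$ its cotangent bundle with canonical symplectic form $\omega=-d\theta$ ($\theta$ the Liouville form). A *nonholonomic RCH system* $(T^*Q,\omega,\mathcal D,H,F,W)$ consists of: a hyperregular Lagrangian $L:TQ\to\mathbb R$ (its Legendre transformation $\mathcal FL:TQ\to T^*Q$ is a diffeomorphism) and its Hamiltonian $H$, $H(\mathcal FL(v))=\langle \mathcal FL(v),v\rangle-L(v)$; a smooth constant-rank distribution $\mathcal D\subset TQ$ which is completely nonholonomic (bracket-generating) and $\mathcal D$-regular (the fibre Hessian of $L$ restricted to $\mathcal D$ is nondegenerate); a smooth fibre-preserving force map $F:T^*Q\to T^*Q$; and a control subset $W\subset T^*Q$. A control law is a smooth fibre-preserving map $u:T^*Q\to T^*Q$ with values in $W$. Put $$\mathcal M=\mathcal FL(\mathcal D),\qquad \mathcal F=(T\pi_Q)^{-1}(\mathcal D),\qquad \mathcal K=\mathcal F\cap T\mathcal M ,$$ and assume the admissibility condition $\dim\mathcal M=\operatorname{rank}\mathcal F$ and the compatibility condition $T\mathcal M\cap\mathcal F^{\perp}=\{0\}$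 ($\perp$ is the $\omega$-orthogonal), so that the restriction $\omega_{\mathcal K}$ of $\omega$ to $\mathcal K$ is nondegenerate. Let $X_{\mathcal K}$ be the $\mathcal K$-valued vector field on $\mathcal M$ with $\mathbf i_{X_{\mathcal K}}\omega_{\mathcal K}=dH|_{\mathcal K}$, and let $\tau_{\mathcal K}v\in\mathcal K$ be determined by $\omega(\tau_{\mathcal K}v,w)=\omega(v,w)$ for all $w\in\mathcal K$. For a fibre-preserving $f:T^*Q\to T^*Q$ let $\mathrm{vlift}(f)X_H$ be the vertical vector field whose value at $z\in T_q^*Q$ is the vertical part of $Tf(X_H(z))$ (with respect to an arbitrary fixed linear projection of $T(T^*Q)$ onto the vertical vectors), translated from $f(z)$ to $z$ in the vector space $T^*_qQ$. The dynamical vector field of the distributional RCH system is $$\tilde X=X_{\mathcal K}+F_{\mathcal K}+u_{\mathcal K},\qquad F_{\mathcal K}=\tau_{\mathcal K}\,\mathrm{vlift}(F)X_H,\quad u_{\mathcal K}=\tau_{\mathcal K}\,\mathrm{vlift}(u)X_H .$$ **Symmetry and reduction.** Let a Lie group $G$ act smoothly on $Q$ so that the cotangent lifted action on $T^*Q$ is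 free and proper, and let $H$ be $G$-invariant, $F$ $G$-equivariant, and $W$ and $\mathcal D$ $G$-invariant. Let $T^*Q/G$ be the quotient manifold, for which the projection $\pi_{/G}:T^*Q\to T^*Q/G$ is a smooth submersion. Let $\mathcal V$ be the tangent distribution of the $G$-orbits, $\mathcal U=\{u\in\mathcal K:\omega(u,v)=0\ \forall v\in\mathcal V\cap\mathcal K\}$, $\bar{\mathcal M}=\pi_{/G}(\mathcal M)$ and $\bar{\mathcal K}=T\pi_{/G}(\mathcal U)$. Let $\omega_{\bar{\mathcal K}}$ be the nondegenerate distributional two-form on $\bar{\mathcal K}$ with $\pi_{/G}^*\omega_{\bar{\mathcal K}}=\omega|_{\mathcal U}$, let $h$ be the function on $T^*Q/G$ with $h\circ\pi_{/G}=H$, and let $X_{\bar{\mathcal K}}$ be the $\bar{\mathcal K}$-valued vector field along $\bar{\mathcal M}$ with $\mathbf i_{X_{\bar{\mathcal K}}}\omega_{\bar{\mathcal K}}=dh|_{\bar{\mathcal K}}$. **Theorem 4.4.** Let $\gamma:Q\to T^*Q$ be a smooth one-form on $Q$ which is $G$-equivariant and satisfies $\operatorname{Im}\gamma\subset\mathcal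 M$ and $T\gamma(\mathcal D)\subset\mathcal K$. Let $\varepsilon:T^*Q\to T^*Q$ be a smooth symplectic map ($\varepsilon^*\omega=\omega$) which is $G$-equivariant and satisfies $\varepsilon(\mathcal M)\subset\mathcal M$. Put $\bar\gamma=\pi_{/G}\circ\gamma$, $\bar\varepsilon=\pi_{/G}\circ\varepsilon$ and $\tilde X^{\varepsilon}=T\pi_Q\circ\tilde X\circ\varepsilon:\mathcal M\to TQ$. Then at each point $z\in\mathcal M$ the Type II Hamilton–Jacobi equation $$T\gamma\cdot\tilde X^{\varepsilon}=X_{\mathcal K}\cdot\varepsilon \qquad\text{in } T(T^*Q)$$ holds if and only if the reduced Type II Hamilton–Jacobi equation $$T\bar\gamma\cdot\tilde X^{\varepsilon}=X_{\bar{\mathcal K}}\cdot\bar\varepsilon\qquad\text{in } T(T^*Q/G)$$ holds at $z$. In particular, $\varepsilon$ is a solution of the first equation (on all of $\mathcal M$) if and only if $\varepsilon$ and $\bar\varepsilon$ satisfy the second one (on all of $\mathcal M$). -/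

import Mathlib

open Bundle
open scoped Manifold ContDiff

noncomputable section

/-! ### Exterior derivatives of one-forms and tangent spaces of subsets -/

section General

variable {E : Type*} [NormedAddCommGroup E] [NormedSpace ℝ E] {H : Type*} [TopologicalSpace H]
  (I : ModelWithCorners ℝ E H) {N : Type*} [TopologicalSpace N] [ChartedSpace H N]

/-- The expression of a one-form `η` on `N` in the preferred chart at `x`: the pullback of `η`
under the inverse of the chart. -/
def oneFormInChart (η : ∀ y : N, TangentSpace I y →L[ℝ] ℝ) (x : N) (y : E) : E →L[ℝ] ℝ :=
  (η ((extChartAt I x).symm y)).comp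
    (mfderivWithin 𝓘(ℝ, E) I (extChartAt I x).symm (Set.range I) y)

/-- The exterior derivative `dη` of a one-form, evaluated at `x` on two tangent vectors, computed in
the preferred chart at `x` (the one through which `T_x N` is identified with the model space):
`dη(v, w) = D_v η(w) - D_w η(v)`. -/
def extDerivOneForm (η : ∀ y : N, TangentSpace I y →L[ℝ] ℝ) (x : N) :
    TangentSpace I x →ₗ[ℝ] TangentSpace I x →ₗ[ℝ] ℝ :=
  let A : E →L[ℝ] E →L[ℝ] ℝ :=
    fderivWithin ℝ (oneFormInChart I η x) (Set.range I) (extChartAt I x x)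
  show E →ₗ[ℝ] E →ₗ[ℝ] ℝ from
    LinearMap.mk₂ ℝ (fun v w : E => A v w - A w v)
      (fun v v' w => by simp only [map_add, add_apply]; ring)
      (fun a v w => by simp only [map_smul, smul_apply, smul_eq_mul]; ring)
      (fun v w w' => by simp only [map_add, add_apply]; ring)
      (fun a v w => by simp only [map_smul, smul_apply, smul_eq_mul]; ring)

/-- The tangent space at `x` of a subset `S` of `N`: spanned by the velocities at time `0` of the
smooth curves in `N` that stay in `S` and pass through `x` at time `0`. When `S` is an embedded
submanifold these velocities already form a subspace, the usual tangent space of `S`. -/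
def tangentSpaceOfSubset (S : Set N) (x : N) : Submodule ℝ (TangentSpace I x) :=
  Submodule.span ℝ {v | ∃ c : ℝ → N, ContMDiff 𝓘(ℝ, ℝ) I ∞ c ∧ (∀ t, c t ∈ S) ∧
    tangentMap 𝓘(ℝ, ℝ) I c ⟨0, (1 : ℝ)⟩ = (⟨x, v⟩ : TangentBundle I N)}

/-- The real number `dh(v)`. -/
def differential (h : N → ℝ) (x : N) (v : TangentSpace I x) : ℝ :=
  mfderiv I 𝓘(ℝ, ℝ) h x v

end General

/-! ### The cotangent bundle and its canonical symplectic form -/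

section Cotangent

variable (E : Type*) [NormedAddCommGroup E] [NormedSpace ℝ E]
  (Q : Type*) [TopologicalSpace Q] [ChartedSpace E Q]

/-- The cotangent space `T_q^* Q`. -/
abbrev CotangentSpace (q : Q) : Type _ :=
  TangentSpace 𝓘(ℝ, E) q →L[ℝ] Trivial Q ℝ q

variable [IsManifold 𝓘(ℝ, E) ∞ Q]

/-- The cotangent bundle `T^* Q`. -/
abbrev CotangentBundle : Type _ := TotalSpace (E →L[ℝ] ℝ) (CotangentSpace E Q)

/-- The model of `T^* Q` as a manifold. -/
abbrev cotangentModel : ModelWithCorners ℝ (E × (E →L[ℝ] ℝ)) (ModelProd E (E →L[ℝ] ℝ)) :=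
  𝓘(ℝ, E).prod 𝓘(ℝ, E →L[ℝ] ℝ)

variable {E Q}

/-- The projection `π_Q : T^* Q → Q`. -/
def cotangentProj (z : CotangentBundle E Q) : Q := z.proj

/-- The tangent map `T_z π_Q`. -/
def tangentProj (z : CotangentBundle E Q) :
    TangentSpace (cotangentModel E) z →L[ℝ] TangentSpace 𝓘(ℝ, E) (cotangentProj z) :=
  mfderiv (cotangentModel E) 𝓘(ℝ, E) cotangentProj z

/-- The tautological (Liouville) one-form `θ_z(v) = z (T π_Q v)` on `T^* Q`. -/
def liouvilleForm (z : CotangentBundle E Q) : TangentSpace (cotangentModel E) z →L[ℝ] ℝ :=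
  (show TangentSpace 𝓘(ℝ, E) (cotangentProj z) →L[ℝ] ℝ from z.2).comp (tangentProj z)

/-- The canonical symplectic form `ω = -dθ` (that is, `dq^i ∧ dp_i`) on `T^* Q`. -/
def canonicalForm (z : CotangentBundle E Q) :
    TangentSpace (cotangentModel E) z →ₗ[ℝ] TangentSpace (cotangentModel E) z →ₗ[ℝ] ℝ :=
  -extDerivOneForm (cotangentModel E) liouvilleForm z

/-- The Hamiltonian vector field of `H`: the vector field with `i_{X_H} ω = dH`. -/
def hamiltonianVectorField (H : CotangentBundle E Q → ℝ) (z : CotangentBundle E Q) :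
    TangentSpace (cotangentModel E) z :=
  Classical.epsilon fun x => ∀ w, canonicalForm z x w = differential (cotangentModel E) H z w

/-- The vertical lift `d/ds (z + s β) |_{s = 0}` at `z ∈ T_q^* Q` of a covector `β ∈ T_q^* Q`. -/
def verticalLift (z : CotangentBundle E Q) (β : CotangentSpace E Q z.proj) :
    TangentSpace (cotangentModel E) z :=
  mfderiv 𝓘(ℝ, E →L[ℝ] ℝ) (cotangentModel E)
    (fun α : E →L[ℝ] ℝ => (⟨z.proj, α⟩ : CotangentBundle E Q)) z.2 β

end Cotangent

/-! ### Distributions on a manifold -/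

section Distributions

variable {E : Type*} [NormedAddCommGroup E] [NormedSpace ℝ E]
  {Q : Type*} [TopologicalSpace Q] [ChartedSpace E Q] [IsManifold 𝓘(ℝ, E) ∞ Q]

/-- `X` is a smooth vector field on the set `U`. -/
def SmoothVectorFieldOn (U : Set Q) (X : ∀ q : Q, TangentSpace 𝓘(ℝ, E) q) : Prop :=
  ContMDiffOn 𝓘(ℝ, E) 𝓘(ℝ, E).tangent ∞ (fun q => (⟨q, X q⟩ : TangentBundle 𝓘(ℝ, E) Q)) U

/-- A smooth distribution of constant rank: locally spanned by a smooth frame. -/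
def IsSmoothDistribution (D : ∀ q : Q, Submodule ℝ (TangentSpace 𝓘(ℝ, E) q)) : Prop :=
  ∃ k : ℕ, ∀ q₀ : Q, ∃ U : Set Q, IsOpen U ∧ q₀ ∈ U ∧
    ∃ X : Fin k → ∀ q : Q, TangentSpace 𝓘(ℝ, E) q, (∀ i, SmoothVectorFieldOn U (X i)) ∧
      ∀ q ∈ U, LinearIndependent ℝ (fun i => X i q) ∧
        Submodule.span ℝ (Set.range fun i => X i q) = D q

/-- The iterated Lie brackets `X`, `[X₁, X₂]`, `[X₁, [X₂, X₃]]`, ... of sections of `D` over an open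
set `U`. -/
inductive IteratedBracket (D : ∀ q : Q, Submodule ℝ (TangentSpace 𝓘(ℝ, E) q)) (U : Set Q) :
    (∀ q : Q, TangentSpace 𝓘(ℝ, E) q) → Prop
  | of_section (X : ∀ q : Q, TangentSpace 𝓘(ℝ, E) q) (hX : SmoothVectorFieldOn U X)
      (hD : ∀ q ∈ U, X q ∈ D q) : IteratedBracket D U X
  | bracket (X Y : ∀ q : Q, TangentSpace 𝓘(ℝ, E) q) (hX : SmoothVectorFieldOn U X)
      (hD : ∀ q ∈ U, X q ∈ D q) (hY : IteratedBracket D U Y) :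
      IteratedBracket D U (VectorField.mlieBracket 𝓘(ℝ, E) X Y)

/-- `D` is completely nonholonomic (bracket-generating). -/
def IsCompletelyNonholonomic (D : ∀ q : Q, Submodule ℝ (TangentSpace 𝓘(ℝ, E) q)) : Prop :=
  ∀ q : Q, Submodule.span ℝ {v | ∃ U : Set Q, IsOpen U ∧ q ∈ U ∧
    ∃ Y : ∀ q : Q, TangentSpace 𝓘(ℝ, E) q, IteratedBracket D U Y ∧ Y q = v} = ⊤

end Distributions

/-! ### Nonholonomic RCH systems -/

section Systems

variable (E : Type*) [NormedAddCommGroup E] [NormedSpace ℝ E]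
  (Q : Type*) [TopologicalSpace Q] [ChartedSpace E Q] [IsManifold 𝓘(ℝ, E) ∞ Q]

variable {E Q} in
/-- The fibre derivative `d/dv L(q, v)` of a Lagrangian. -/
def fiberDeriv (L : TangentBundle 𝓘(ℝ, E) Q → ℝ) (q : Q) (v : E) : E →L[ℝ] ℝ :=
  fderiv ℝ (fun v' : E => L ⟨q, v'⟩) v

variable {E Q} in
/-- The Legendre transformation `FL : TQ → T^* Q`. -/
def legendre (L : TangentBundle 𝓘(ℝ, E) Q → ℝ) (v : TangentBundle 𝓘(ℝ, E) Q) :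
    CotangentBundle E Q :=
  ⟨v.proj, fiberDeriv (E := E) L v.proj v.2⟩

/-- A fibre-preserving map `T^* Q → T^* Q`. -/
structure FiberMap where
  /-- the maps of the fibres -/
  onFiber : ∀ q : Q, CotangentSpace E Q q → CotangentSpace E Q q
  smooth : ContMDiff (cotangentModel E) (cotangentModel E) ∞
    fun z : CotangentBundle E Q => (⟨z.proj, onFiber z.proj z.2⟩ : CotangentBundle E Q)

variable {E Q} in
/-- A fibre-preserving map, as a map of total spaces. -/
def FiberMap.total (F : FiberMap E Q) (z : CotangentBundle E Q) : CotangentBundle E Q :=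
  ⟨z.proj, F.onFiber z.proj z.2⟩

/-- A projection of `T(T^* Q)` onto the vertical vectors, the vertical space at `z ∈ T_q^* Q` being
identified with `T_q^* Q`. It gives the vertical part of a vector tangent to `T^* Q`. -/
structure VerticalPart where
  /-- the vertical part -/
  toFun : ∀ z : CotangentBundle E Q,
    TangentSpace (cotangentModel E) z →L[ℝ] CotangentSpace E Q z.proj
  toFun_verticalLift : ∀ (z : CotangentBundle E Q) (β : CotangentSpace E Q z.proj),
    toFun z (verticalLift z β) = β

variable {E Q} in
/-- The change `vlift(F) X_H` of the Hamiltonian vector field of `H` under a fibre-preserving map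
`F`: the vertical part of the vector `TF (X_H(z))` at `F(z)`, transported along the straight line
from `F(z)` to `z` in the vector space `T_q^* Q`, and considered as a vertical vector at `z`. -/
def vliftField (V : VerticalPart E Q) (H : CotangentBundle E Q → ℝ) (F : FiberMap E Q)
    (z : CotangentBundle E Q) : TangentSpace (cotangentModel E) z :=
  verticalLift z (V.toFun (F.total z)
    (mfderiv (cotangentModel E) (cotangentModel E) F.total z (hamiltonianVectorField H z)))

/-- A nonholonomic RCH system `(T^* Q, ω, D, H, F, W)`, with `ω` the canonical symplectic form.
The Hamiltonian `H` comes from the hyperregular Lagrangian `L`, and `D` is a completely nonholonomic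
and `D`-regular constraint. -/
structure NonholonomicRCHSystem where
  /-- the Lagrangian -/
  L : TangentBundle 𝓘(ℝ, E) Q → ℝ
  smooth_L : ContMDiff 𝓘(ℝ, E).tangent 𝓘(ℝ, ℝ) ∞ L
  /-- the Legendre transformation is a diffeomorphism -/
  hyperregular : ∃ Φ : TangentBundle 𝓘(ℝ, E) Q ≃ₘ⟮𝓘(ℝ, E).tangent, cotangentModel E⟯
    CotangentBundle E Q, ∀ v, Φ v = legendre L v
  /-- the Hamiltonian -/
  H : CotangentBundle E Q → ℝ
  H_legendre : ∀ (q : Q) (v : TangentSpace 𝓘(ℝ, E) q),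
    H (legendre L ⟨q, v⟩) = fiberDeriv L q v v - L ⟨q, v⟩
  /-- the nonholonomic constraint -/
  D : ∀ q : Q, Submodule ℝ (TangentSpace 𝓘(ℝ, E) q)
  smooth_D : IsSmoothDistribution D
  completelyNonholonomic : IsCompletelyNonholonomic D
  /-- the Hessian of `L` restricted to `D` is nondegenerate -/
  regular : ∀ (q : Q), ∀ v ∈ D q, ∀ a ∈ D q,
    (∀ b ∈ D q, fderiv ℝ (fiberDeriv L q) v a b = 0) → a = 0
  /-- the external force map -/
  F : FiberMap E Q
  /-- the control subset -/
  W : Set (CotangentBundle E Q)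

namespace NonholonomicRCHSystem

variable {E Q} (S : NonholonomicRCHSystem E Q)

/-- The constraint submanifold `M = FL(D)`. -/
def constraintSet : Set (CotangentBundle E Q) :=
  legendre S.L '' {v | v.2 ∈ S.D v.proj}

/-- The tangent space `T_z M`. -/
def tangentM (z : CotangentBundle E Q) : Submodule ℝ (TangentSpace (cotangentModel E) z) :=
  tangentSpaceOfSubset (cotangentModel E) S.constraintSet z

/-- The distribution `𝓕 = (Tπ_Q)⁻¹(D)`. -/
def distF (z : CotangentBundle E Q) : Submodule ℝ (TangentSpace (cotangentModel E) z) :=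
  (S.D (cotangentProj z)).comap (tangentProj z).toLinearMap

/-- The distribution `𝓚 = 𝓕 ∩ TM` along `M`. -/
def distK (z : CotangentBundle E Q) : Submodule ℝ (TangentSpace (cotangentModel E) z) :=
  S.distF z ⊓ S.tangentM z

/-- The admissibility condition `dim M = rank 𝓕` and the compatibility condition
`TM ∩ 𝓕^⊥ = 0`, where `𝓕^⊥` is the symplectic orthogonal of `𝓕`. They make the restriction `ω_𝓚` of
the canonical symplectic form to `𝓚` nondegenerate. -/
structure IsAdmissible : Prop where
  admissible : ∀ z ∈ S.constraintSet,
    Module.finrank ℝ (S.tangentM z) = Module.finrank ℝ (S.distF z)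
  compatible : ∀ z ∈ S.constraintSet, ∀ v ∈ S.tangentM z,
    (∀ w ∈ S.distF z, canonicalForm z v w = 0) → v = 0

/-- The nonholonomic dynamical vector field `X_𝓚` on `M`: it takes values in `𝓚` and solves the
distributional Hamiltonian equation `i_{X_𝓚} ω_𝓚 = dH_𝓚`. -/
def fieldXK (z : CotangentBundle E Q) : TangentSpace (cotangentModel E) z :=
  Classical.epsilon fun x => x ∈ S.distK z ∧
    ∀ w ∈ S.distK z, canonicalForm z x w = differential (cotangentModel E) S.H z w

/-- The restriction `τ_𝓚 v` of a tangent vector `v` to `𝓚`: the vector of `𝓚` with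
`ω(τ_𝓚 v, w) = ω(v, w)` for all `w` in `𝓚`. In particular `X_𝓚 = τ_𝓚 X_H`. -/
def tauK (z : CotangentBundle E Q) (v : TangentSpace (cotangentModel E) z) :
    TangentSpace (cotangentModel E) z :=
  Classical.epsilon fun x => x ∈ S.distK z ∧
    ∀ w ∈ S.distK z, canonicalForm z x w = canonicalForm z v w

/-- The dynamical vector field `X̃ = X_𝓚 + F_𝓚 + u_𝓚` on `M` of the distributional RCH system with
control law `u`, where `F_𝓚 = τ_𝓚 vlift(F) X_H` and `u_𝓚 = τ_𝓚 vlift(u) X_H`. -/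
def dynamicalField (V : VerticalPart E Q) (u : FiberMap E Q) (z : CotangentBundle E Q) :
    TangentSpace (cotangentModel E) z :=
  S.fieldXK z + S.tauK z (vliftField V S.H S.F z) + S.tauK z (vliftField V S.H u z)

end NonholonomicRCHSystem

variable {E Q} in
/-- A one-form `γ` as a map `Q → T^* Q`. -/
def oneFormMap (γ : ∀ q : Q, CotangentSpace E Q q) (q : Q) : CotangentBundle E Q := ⟨q, γ q⟩

variable {E Q} in
/-- `ε : T^* Q → T^* Q` is a symplectic map: it is smooth and `ε^* ω = ω`. -/
structure IsSymplecticMap (ε : CotangentBundle E Q → CotangentBundle E Q) : Prop where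
  smooth : ContMDiff (cotangentModel E) (cotangentModel E) ∞ ε
  pullback : ∀ (z : CotangentBundle E Q) (v w : TangentSpace (cotangentModel E) z),
    canonicalForm (ε z) (mfderiv (cotangentModel E) (cotangentModel E) ε z v)
      (mfderiv (cotangentModel E) (cotangentModel E) ε z w) = canonicalForm z v w

namespace NonholonomicRCHSystem

variable {E Q} (S : NonholonomicRCHSystem E Q)

/-- The map `X̃^ε = Tπ_Q ∘ X̃ ∘ ε`, with values in `TQ`. -/
def fieldEps (V : VerticalPart E Q) (u : FiberMap E Q)
    (ε : CotangentBundle E Q → CotangentBundle E Q) (z : CotangentBundle E Q) :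
    TangentBundle 𝓘(ℝ, E) Q :=
  tangentMap (cotangentModel E) 𝓘(ℝ, E) cotangentProj ⟨ε z, S.dynamicalField V u (ε z)⟩

/-- The Type II Hamilton-Jacobi equation `Tγ ∘ X̃^ε = X_𝓚 ∘ ε` at the point `z`, an equality in the
tangent bundle of `T^* Q` (so that the base points have to agree as well). -/
def TypeIIAt (V : VerticalPart E Q) (u : FiberMap E Q) (γ : ∀ q : Q, CotangentSpace E Q q)
    (ε : CotangentBundle E Q → CotangentBundle E Q) (z : CotangentBundle E Q) : Prop :=
  tangentMap 𝓘(ℝ, E) (cotangentModel E) (oneFormMap γ) (S.fieldEps V u ε z) =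
    (⟨ε z, S.fieldXK (ε z)⟩ : TangentBundle (cotangentModel E) (CotangentBundle E Q))

end NonholonomicRCHSystem

end Systems

/-! ### Symmetry and reduction -/

section Action

variable {G : Type*} [Group G]
  {E : Type*} [NormedAddCommGroup E] [NormedSpace ℝ E]
  {Q : Type*} [TopologicalSpace Q] [ChartedSpace E Q] [MulAction G Q]

/-- The tangent map `T_q Φ_g : T_q Q → T_{gq} Q` of the action of `g`. -/
def tangentAction (g : G) (q : Q) :
    TangentSpace 𝓘(ℝ, E) q →L[ℝ] TangentSpace 𝓘(ℝ, E) (g • q) :=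
  mfderiv 𝓘(ℝ, E) 𝓘(ℝ, E) (fun x : Q => g • x) q

/-- The cotangent lifted action of `g` on `T^* Q`: `α ∈ T_q^* Q` is sent to
`α ∘ (T_q Φ_g)⁻¹ ∈ T_{gq}^* Q`. -/
def cotangentLift [IsManifold 𝓘(ℝ, E) ∞ Q] (g : G) (z : CotangentBundle E Q) :
    CotangentBundle E Q :=
  ⟨g • z.proj, z.2.comp (tangentAction g z.proj).inverse⟩

end Action

section GroupLaws

/-- The covector `α ∘ (T_q f)⁻¹` at `f(q)`. -/
def pushCovector {E : Type*} [NormedAddCommGroup E] [NormedSpace ℝ E]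
    {Q : Type*} [TopologicalSpace Q] [ChartedSpace E Q] [IsManifold 𝓘(ℝ, E) ∞ Q]
    (f : Q → Q) (z : CotangentBundle E Q) : CotangentBundle E Q :=
  ⟨f z.proj, z.2.comp (mfderiv 𝓘(ℝ, E) 𝓘(ℝ, E) f z.proj).inverse⟩

theorem cotangentLift_one (G : Type*) [Group G]
    (E : Type*) [NormedAddCommGroup E] [NormedSpace ℝ E]
    (Q : Type*) [TopologicalSpace Q] [ChartedSpace E Q] [IsManifold 𝓘(ℝ, E) ∞ Q]
    [MulAction G Q] (z : CotangentBundle E Q) :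
    cotangentLift (1 : G) z = z := by
  have h : (fun x : Q => (1 : G) • x) = id := by ext x; simp
  change pushCovector (fun x : Q => (1 : G) • x) z = z
  rw [h]
  simp [pushCovector, mfderiv_id]

theorem cotangentLift_mul (EG : Type*) [NormedAddCommGroup EG] [NormedSpace ℝ EG]
    (G : Type*) [TopologicalSpace G] [ChartedSpace EG G] [Group G]
    (E : Type*) [NormedAddCommGroup E] [NormedSpace ℝ E]
    (Q : Type*) [TopologicalSpace Q] [ChartedSpace E Q] [IsManifold 𝓘(ℝ, E) ∞ Q]
    [MulAction G Q] [ContMDiffSMul 𝓘(ℝ, EG) 𝓘(ℝ, E) ∞ G Q]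
    (g h : G) (z : CotangentBundle E Q) :
    cotangentLift (g * h) z = cotangentLift g (cotangentLift h z) := by
  have hd : ∀ (k : G) (x : Q), MDifferentiableAt 𝓘(ℝ, E) 𝓘(ℝ, E) (fun x : Q => k • x) x :=
    fun k x => (ContMDiffSMul.contMDiff_const_smul (I := 𝓘(ℝ, EG)) (n := ∞) k).mdifferentiable
      (by simp) x
  have hi : (mfderiv 𝓘(ℝ, E) 𝓘(ℝ, E) (fun x : Q => h • x) z.proj).IsInvertible :=
    ⟨(Diffeomorph.smul 𝓘(ℝ, EG) 𝓘(ℝ, E) ∞ h).mfderivToContinuousLinearEquiv (by simp) z.proj, rfl⟩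
  have hc : (fun x : Q => (g * h) • x) = (fun x : Q => g • x) ∘ (fun x : Q => h • x) := by
    ext x; simp [mul_smul]
  change pushCovector (fun x : Q => (g * h) • x) z = _
  rw [hc, pushCovector, mfderiv_comp _ (hd g _) (hd h _), hi.inverse_comp_of_right]
  rfl

end GroupLaws

section Quotient

variable (EG : Type*) [NormedAddCommGroup EG] [NormedSpace ℝ EG]
  (G : Type*) [TopologicalSpace G] [ChartedSpace EG G] [Group G]
  (E : Type*) [NormedAddCommGroup E] [NormedSpace ℝ E]
  (Q : Type*) [TopologicalSpace Q] [ChartedSpace E Q] [IsManifold 𝓘(ℝ, E) ∞ Q]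
  [MulAction G Q] [ContMDiffSMul 𝓘(ℝ, EG) 𝓘(ℝ, E) ∞ G Q]

/-- Two covectors are equivalent if they lie on the same orbit of the cotangent lifted action. -/
def orbitSetoid : Setoid (CotangentBundle E Q) where
  r z w := ∃ g : G, cotangentLift g z = w
  iseqv :=
    { refl := fun z => ⟨1, cotangentLift_one G E Q z⟩
      symm := by
        rintro z w ⟨g, rfl⟩
        exact ⟨g⁻¹, by rw [← cotangentLift_mul EG, inv_mul_cancel, cotangentLift_one]⟩
      trans := by
        rintro z w y ⟨g, rfl⟩ ⟨h, rfl⟩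
        exact ⟨h * g, cotangentLift_mul EG G E Q h g z⟩ }

/-- The orbit space `T^* Q / G`, with the quotient topology. -/
abbrev OrbitSpace : Type _ := Quotient (orbitSetoid EG G E Q)

/-- The projection `π_{/G} : T^* Q → T^* Q / G`. -/
def orbitProj (z : CotangentBundle E Q) : OrbitSpace EG G E Q := Quotient.mk _ z

end Quotient

section Reduction

variable {EG : Type*} [NormedAddCommGroup EG] [NormedSpace ℝ EG]
  {G : Type*} [TopologicalSpace G] [ChartedSpace EG G] [Group G]
  {E : Type*} [NormedAddCommGroup E] [NormedSpace ℝ E]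
  {Q : Type*} [TopologicalSpace Q] [ChartedSpace E Q] [IsManifold 𝓘(ℝ, E) ∞ Q]
  [MulAction G Q] [ContMDiffSMul 𝓘(ℝ, EG) 𝓘(ℝ, E) ∞ G Q]

namespace NonholonomicRCHSystem

variable (S : NonholonomicRCHSystem E Q)

variable (G) in
/-- `G` is a symmetry group of the nonholonomic RCH system: the cotangent lifted action is free and
proper, and `H`, `F`, `W` and `D` are invariant. -/
structure IsSymmetric : Prop where
  free : ∀ (g : G) (z : CotangentBundle E Q), cotangentLift g z = z → g = 1
  proper : IsProperMap fun p : G × CotangentBundle E Q => (cotangentLift p.1 p.2, p.2)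
  invariant_H : ∀ (g : G) (z : CotangentBundle E Q), S.H (cotangentLift g z) = S.H z
  invariant_F : ∀ (g : G) (z : CotangentBundle E Q),
    S.F.total (cotangentLift g z) = cotangentLift g (S.F.total z)
  invariant_W : ∀ (g : G), ∀ z ∈ S.W, cotangentLift g z ∈ S.W
  invariant_D : ∀ (g : G) (q : Q), ∀ v ∈ S.D q, tangentAction g q v ∈ S.D (g • q)

variable (EG G) in
/-- The space `𝓥_z` tangent to the orbit of `z`, spanned by the infinitesimal symmetries at `z`. -/
def distV (z : CotangentBundle E Q) : Submodule ℝ (TangentSpace (cotangentModel E) z) :=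
  Submodule.span ℝ {v | ∃ ξ : TangentSpace 𝓘(ℝ, EG) (1 : G),
    tangentMap 𝓘(ℝ, EG) (cotangentModel E) (fun g : G => cotangentLift g z) ⟨1, ξ⟩ =
      (⟨z, v⟩ : TangentBundle (cotangentModel E) (CotangentBundle E Q))}

variable (EG G) in
/-- The distribution `𝓤 = {u ∈ 𝓚 | ω_𝓚(u, v) = 0 for all v ∈ 𝓥 ∩ 𝓚}` along `M`. -/
def distU (z : CotangentBundle E Q) : Submodule ℝ (TangentSpace (cotangentModel E) z) where
  carrier := {u | u ∈ S.distK z ∧ ∀ v ∈ distV EG G z ⊓ S.distK z, canonicalForm z u v = 0}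
  add_mem' := fun ha hb => ⟨add_mem ha.1 hb.1, fun v hv => by
    rw [map_add, LinearMap.add_apply, ha.2 v hv, hb.2 v hv, add_zero]⟩
  zero_mem' := ⟨zero_mem _, fun v _ => by rw [map_zero, LinearMap.zero_apply]⟩
  smul_mem' := fun a _ hu => ⟨Submodule.smul_mem _ a hu.1, fun v hv => by
    rw [map_smul, LinearMap.smul_apply, hu.2 v hv, smul_zero]⟩

variable {EP : Type*} [NormedAddCommGroup EP] [NormedSpace ℝ EP]
  [ChartedSpace EP (OrbitSpace EG G E Q)]

variable (EG G EP) in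
/-- The tangent map `T_z π_{/G}`. -/
def tangentOrbitProj (z : CotangentBundle E Q) :
    TangentSpace (cotangentModel E) z →L[ℝ] TangentSpace 𝓘(ℝ, EP) (orbitProj EG G E Q z) :=
  mfderiv (cotangentModel E) 𝓘(ℝ, EP) (orbitProj EG G E Q) z

variable (EG G EP) in
/-- The fibre at `π_{/G}(z)`, for `z ∈ M`, of the reduced distribution `𝓚̄ = Tπ_{/G}(𝓤)`. -/
def distKbar (z : CotangentBundle E Q) :
    Submodule ℝ (TangentSpace 𝓘(ℝ, EP) (orbitProj EG G E Q z)) :=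
  (S.distU EG G z).map (tangentOrbitProj EG G EP z).toLinearMap

variable (EG G EP) in
/-- The reduced distributional system on `M̄ = π_{/G}(M)`: the nondegenerate distributional two-form
`ω_𝓚̄` on `𝓚̄` with `π_{/G}^* ω_𝓚̄ = ω_𝓤`, the reduced Hamiltonian `h` with `h ∘ π_{/G} = H`, and the
nonholonomic reduced dynamical vector field `X_𝓚̄` on `M̄`, which takes values in `𝓚̄` and solves the
reduced distributional Hamiltonian equation `i_{X_𝓚̄} ω_𝓚̄ = dh_𝓚̄`. These conditions determine `h`,
and `ω_𝓚̄` and `X_𝓚̄` over `M̄`; only these values matter. Every point of `M̄` is written as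
`π_{/G}(z)` with `z ∈ M`. -/
structure ReducedSystem where
  /-- the reduced Hamiltonian -/
  h : OrbitSpace EG G E Q → ℝ
  smooth_h : ContMDiff 𝓘(ℝ, EP) 𝓘(ℝ, ℝ) ∞ h
  h_orbitProj : ∀ z, h (orbitProj EG G E Q z) = S.H z
  /-- the reduced distributional two-form -/
  form : ∀ x : OrbitSpace EG G E Q,
    TangentSpace 𝓘(ℝ, EP) x →ₗ[ℝ] TangentSpace 𝓘(ℝ, EP) x →ₗ[ℝ] ℝ
  pullback_form : ∀ z ∈ S.constraintSet, ∀ v ∈ S.distU EG G z, ∀ w ∈ S.distU EG G z,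
    form (orbitProj EG G E Q z) (tangentOrbitProj EG G EP z v) (tangentOrbitProj EG G EP z w) =
      canonicalForm z v w
  nondegenerate_form : ∀ z ∈ S.constraintSet, ∀ a ∈ S.distKbar EG G EP z,
    (∀ b ∈ S.distKbar EG G EP z, form (orbitProj EG G E Q z) a b = 0) → a = 0
  /-- the reduced dynamical vector field -/
  field : ∀ x : OrbitSpace EG G E Q, TangentSpace 𝓘(ℝ, EP) x
  field_mem : ∀ z ∈ S.constraintSet, field (orbitProj EG G E Q z) ∈ S.distKbar EG G EP z
  hamilton : ∀ z ∈ S.constraintSet, ∀ w ∈ S.distKbar EG G EP z,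
    form (orbitProj EG G E Q z) (field (orbitProj EG G E Q z)) w =
      differential 𝓘(ℝ, EP) h (orbitProj EG G E Q z) w

variable {S} in
/-- The reduced Type II Hamilton-Jacobi equation `Tγ̄ ∘ X̃^ε = X_𝓚̄ ∘ ε̄` at the point `z`, where
`γ̄ = π_{/G} ∘ γ` and `ε̄ = π_{/G} ∘ ε`; an equality in the tangent bundle of `T^* Q / G`. -/
def ReducedSystem.TypeIIAt (R : S.ReducedSystem EG G EP) (V : VerticalPart E Q) (u : FiberMap E Q)
    (γ : ∀ q : Q, CotangentSpace E Q q) (ε : CotangentBundle E Q → CotangentBundle E Q)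
    (z : CotangentBundle E Q) : Prop :=
  tangentMap 𝓘(ℝ, E) 𝓘(ℝ, EP) (orbitProj EG G E Q ∘ oneFormMap γ) (S.fieldEps V u ε z) =
    (⟨orbitProj EG G E Q (ε z), R.field (orbitProj EG G E Q (ε z))⟩ :
      TangentBundle 𝓘(ℝ, EP) (OrbitSpace EG G E Q))

end NonholonomicRCHSystem

end Reduction

/-! ### Cotangent charts and the Darboux expression of the canonical form -/

section CanonicalForm

open Set Filter Topology

variable {E : Type*} [NormedAddCommGroup E] [NormedSpace ℝ E]
  {Q : Type*} [TopologicalSpace Q] [ChartedSpace E Q] [IsManifold 𝓘(ℝ, E) ∞ Q]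

/-! The two equations are linked by three facts, used at the point `p = ε z` of `M`.

First, force and control are invisible after projection to `TQ`. They enter as `τ_𝓚` of vertical
vectors, and `τ_𝓚` preserves verticality: `ω(vlift β, w)` depends only on `β` and on `Tπ_Q w`, which
lies in `D` for `w ∈ 𝓚`, and by `D`-regularity some vertical vector of `𝓚` has the same values on
`D` as `β` (`exists_verticalLift_mem_distK`, `tangentProj_dynamicalField`). So the Type II equation
says that `Tγ (Tπ_Q x) = x` for `x = X_𝓚(p)`.

Second, `X_𝓚` projects to `X_𝓚̄`. Since `H` factors through the orbit space, `dH` vanishes on orbit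
directions, so `X_𝓚` lies in `𝓤`, and nondegeneracy of the reduced form identifies its image
(`tangentOrbitProj_fieldXK`). So the reduced equation is the image of the original one under
`Tπ_{/G}`, which gives one direction.

Third, this image loses nothing (`tangentMap_oneFormMap_eq_iff`). If `p` and `γ(π_Q p)` lie on one
orbit, equivariance puts `p` in the image of `γ`, so they are equal. The difference `d` of the two
tangent vectors is then in the kernel of `Tπ_{/G}`, hence is the velocity of a curve inside an
orbit. That orbit lies in the image of `γ`, so `Tγ (Tπ_Q d) = d`; but `Tπ_Q d = 0` because `π_Q ∘ γ
= id`. -/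

theorem extChartAt_cotangentBundle_apply (z w : CotangentBundle E Q) :
    extChartAt (cotangentModel E) z w = (extChartAt 𝓘(ℝ, E) z.proj w.proj,
      (show E →L[ℝ] ℝ from w.2.comp
        ((trivializationAt E (TangentSpace 𝓘(ℝ, E)) z.proj).symmL ℝ w.proj))) := by
  change (cotangentModel E) (chartAt (ModelProd E (E →L[ℝ] ℝ)) z w) = _
  rw [hom_chart]
  simp [ContinuousLinearMap.inCoordinates]

/-- `T_q Q` is identified with `E` through the preferred chart at `q` itself, so no coordinate
change occurs at the base point. -/
theorem symmL_trivializationAt_self (q : Q) :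
    (trivializationAt E (TangentSpace 𝓘(ℝ, E)) q).symmL ℝ q = ContinuousLinearMap.id ℝ E := by
  rw [TangentBundle.symmL_trivializationAt_eq_core (mem_chart_source E q)]
  ext v
  exact tangentCoordChange_self (I := 𝓘(ℝ, E)) (mem_extChartAt_source q)

theorem mdifferentiable_cotangentProj :
    MDifferentiable (cotangentModel E) 𝓘(ℝ, E) (cotangentProj : CotangentBundle E Q → Q) :=
  (Bundle.contMDiff_proj (n := ∞) (IB := 𝓘(ℝ, E)) (CotangentSpace E Q)).mdifferentiable (by simp)

theorem tangentProj_apply (z : CotangentBundle E Q) (v : E × (E →L[ℝ] ℝ)) :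
    tangentProj z v = v.1 := by
  have h := mdifferentiable_cotangentProj z
  rw [tangentProj, h.mfderiv]
  have hev : writtenInExtChartAt (cotangentModel E) 𝓘(ℝ, E) z cotangentProj
      =ᶠ[𝓝 (extChartAt (cotangentModel E) z z)] Prod.fst := by
    filter_upwards [extChartAt_target_mem_nhds (I := cotangentModel E) z] with y hy
    have := (extChartAt (cotangentModel E) z).right_inv hy
    rw [extChartAt_cotangentBundle_apply] at this
    exact congrArg Prod.fst this
  rw [ModelWithCorners.range_eq_univ, fderivWithin_univ, hev.fderiv_eq]
  erw [fderiv_fst]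
  rfl

/-- The preferred chart at `z` restricts to the identity on the fibre through `z`, so the inclusion
of this fibre reads `α ↦ (const, α)`. -/
theorem hasMFDerivAt_cotangentFiber (z : CotangentBundle E Q) :
    HasMFDerivAt 𝓘(ℝ, E →L[ℝ] ℝ) (cotangentModel E)
      (fun α : E →L[ℝ] ℝ => (⟨z.proj, α⟩ : CotangentBundle E Q)) z.2
      (ContinuousLinearMap.inr ℝ E (E →L[ℝ] ℝ)) := by
  have hw : ∀ α : E →L[ℝ] ℝ, extChartAt (cotangentModel E) z
      (⟨z.proj, α⟩ : CotangentBundle E Q) = (extChartAt 𝓘(ℝ, E) z.proj z.proj, α) := by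
    intro α
    rw [extChartAt_cotangentBundle_apply, symmL_trivializationAt_self]
    rfl
  have hc : ContMDiff 𝓘(ℝ, E →L[ℝ] ℝ) (cotangentModel E) ∞
      (fun α : E →L[ℝ] ℝ => (⟨z.proj, α⟩ : CotangentBundle E Q)) := by
    intro α
    refine (contMDiffAt_hom_bundle (IB := 𝓘(ℝ, E))
      (fun α : E →L[ℝ] ℝ => (⟨z.proj, α⟩ : CotangentBundle E Q))).2 ?_
    refine ⟨contMDiffAt_const, ?_⟩
    simp only [ContinuousLinearMap.inCoordinates, symmL_trivializationAt_self]
    have hid : ∀ β : E →L[ℝ] ℝ,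
        ((trivializationAt ℝ (Trivial Q ℝ) z.proj).continuousLinearMapAt ℝ z.proj).comp
          (β.comp (ContinuousLinearMap.id ℝ E)) = β := by
      intro β
      ext v
      simp
    exact (contMDiffAt_id (I := 𝓘(ℝ, E →L[ℝ] ℝ)) (M := E →L[ℝ] ℝ)).congr_of_eventuallyEq
      (.of_forall hid)
  refine ⟨hc.continuous.continuousAt, ?_⟩
  change HasFDerivWithinAt (fun α : E →L[ℝ] ℝ => extChartAt (cotangentModel E) z
      (⟨z.proj, α⟩ : CotangentBundle E Q)) _ _ _
  simp_rw [hw]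
  exact (hasFDerivAt_prodMk_right _ _).hasFDerivWithinAt

theorem verticalLift_apply (z : CotangentBundle E Q) (β : CotangentSpace E Q z.proj) :
    verticalLift z β = ((0, β) : E × (E →L[ℝ] ℝ)) := by
  rw [verticalLift, (hasMFDerivAt_cotangentFiber z).mfderiv]
  rfl

/-- This is `θ = p dq`: the fibre coordinate of a covector is its composite with the inverse
trivialization of `TQ`, the same map that appears in the derivative of `π_Q` read in the chart. A
germ at the base point suffices, since it will only be differentiated there. -/
theorem oneFormInChart_liouvilleForm_eventuallyEq (z : CotangentBundle E Q) :
    oneFormInChart (cotangentModel E) liouvilleForm z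
      =ᶠ[𝓝 (extChartAt (cotangentModel E) z z)]
        fun y => y.2.comp (ContinuousLinearMap.fst ℝ E (E →L[ℝ] ℝ)) := by
  set φ := extChartAt (cotangentModel E) z with hφ
  have hbase : ∀ y ∈ φ.target, cotangentProj (φ.symm y) = (extChartAt 𝓘(ℝ, E) z.proj).symm y.1 ∧
      y.1 ∈ (extChartAt 𝓘(ℝ, E) z.proj).target := by
    intro y hy
    have h1 := φ.right_inv hy
    have h2 := φ.map_target hy
    rw [hφ, extChartAt_cotangentBundle_apply] at h1
    rw [hφ, extChartAt_source] at h2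
    have h3 : (φ.symm y).proj ∈ (extChartAt 𝓘(ℝ, E) z.proj).source := by
      rw [extChartAt_source]
      generalize φ.symm y = p at h2
      simp only [FiberBundle.chartedSpace_chartAt, mfld_simps] at h2
      exact h2.1.1
    rw [← congrArg Prod.fst h1]
    exact ⟨((extChartAt 𝓘(ℝ, E) z.proj).left_inv h3).symm,
      (extChartAt 𝓘(ℝ, E) z.proj).map_source h3⟩
  have hopen : ∀ᶠ y in 𝓝 (φ z), y ∈ φ.target :=
    extChartAt_target_mem_nhds (I := cotangentModel E) z
  -- The chart target is needed as a neighbourhood of `y`, not just as a set containing it, because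
  -- derivatives are taken at `y`.
  filter_upwards [hopen.eventually_nhds] with y hy
  have hyt := hy.self_of_nhds
  obtain ⟨hy1, hy2⟩ := hbase y hyt
  have hchain : (tangentProj (φ.symm y)).comp
      (mfderivWithin 𝓘(ℝ, E × (E →L[ℝ] ℝ)) (cotangentModel E) φ.symm (range (cotangentModel E)) y) =
      (show E →L[ℝ] E from (trivializationAt E (TangentSpace 𝓘(ℝ, E)) z.proj).symmL ℝ
        (φ.symm y).proj).comp (ContinuousLinearMap.fst ℝ E (E →L[ℝ] ℝ)) := by
    rw [ModelWithCorners.range_eq_univ, mfderivWithin_univ]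
    have hd : MDifferentiableAt 𝓘(ℝ, E × (E →L[ℝ] ℝ)) (cotangentModel E) φ.symm y :=
      (contMDiffOn_extChartAt_symm (n := ∞) z).mdifferentiableOn (by simp) y hyt |>.mdifferentiableAt
        hy
    have hd' : MDifferentiableAt 𝓘(ℝ, E) 𝓘(ℝ, E) (extChartAt 𝓘(ℝ, E) z.proj).symm y.1 :=
      (contMDiffOn_extChartAt_symm (n := ∞) z.proj).mdifferentiableOn (by simp) y.1 hy2
        |>.mdifferentiableAt (extChartAt_target_mem_nhds' hy2)
    have hx : (φ.symm y).proj ∈ (chartAt E z.proj).source := by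
      change cotangentProj (φ.symm y) ∈ _
      rw [hy1, ← extChartAt_source 𝓘(ℝ, E)]
      exact (extChartAt 𝓘(ℝ, E) z.proj).map_target hy2
    have hxy : extChartAt 𝓘(ℝ, E) z.proj (φ.symm y).proj = y.1 := by
      change extChartAt 𝓘(ℝ, E) z.proj (cotangentProj (φ.symm y)) = _
      rw [hy1]
      exact (extChartAt 𝓘(ℝ, E) z.proj).right_inv hy2
    rw [TangentBundle.symmL_trivializationAt hx, hxy, ModelWithCorners.range_eq_univ,
      mfderivWithin_univ]
    -- Differentiating the two sides of this identity by the chain rule gives the claim.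
    have hev : cotangentProj ∘ φ.symm =ᶠ[𝓝 y] (extChartAt 𝓘(ℝ, E) z.proj).symm ∘ Prod.fst := by
      filter_upwards [hy] with y' hy'
      exact (hbase y' hy').1
    have e1 := mfderiv_comp y (mdifferentiable_cotangentProj (φ.symm y)) hd
    have e2 : HasMFDerivAt 𝓘(ℝ, E × (E →L[ℝ] ℝ)) 𝓘(ℝ, E) (Prod.fst : E × (E →L[ℝ] ℝ) → E) y
        (ContinuousLinearMap.fst ℝ E (E →L[ℝ] ℝ)) := hasFDerivAt_fst.hasMFDerivAt
    have e3 := (HasMFDerivAt.comp y hd'.hasMFDerivAt e2).mfderiv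
    rw [← hev.mfderiv_eq, e1] at e3
    exact e3
  have h1 := φ.right_inv hyt
  rw [hφ, extChartAt_cotangentBundle_apply] at h1
  have h2 := congrArg Prod.snd h1
  change (show TangentSpace 𝓘(ℝ, E) (cotangentProj (φ.symm y)) →L[ℝ] ℝ from
    (φ.symm y).2).comp ((tangentProj (φ.symm y)).comp
      (mfderivWithin 𝓘(ℝ, E × (E →L[ℝ] ℝ)) (cotangentModel E) φ.symm
        (range (cotangentModel E)) y)) = _
  rw [hchain]
  conv_rhs => rw [← h2]
  rfl

theorem fderiv_snd_comp_fst (y v w : E × (E →L[ℝ] ℝ)) :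
    fderiv ℝ (fun y : E × (E →L[ℝ] ℝ) => y.2.comp (ContinuousLinearMap.fst ℝ E (E →L[ℝ] ℝ))) y v w =
      v.2 w.1 := by
  rw [fderiv_clm_comp differentiableAt_snd (differentiableAt_const _)]
  simp [fderiv_snd]

/-- The preferred charts are cotangent charts, hence Darboux charts. All later computations with `ω`
are thereby reduced to linear algebra on `E × E^*`. -/
theorem canonicalForm_apply (z : CotangentBundle E Q) (v w : E × (E →L[ℝ] ℝ)) :
    canonicalForm z v w = w.2 v.1 - v.2 w.1 := by
  have hB : ∀ v w, fderivWithin ℝ (oneFormInChart (cotangentModel E) liouvilleForm z)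
      (range (cotangentModel E)) (extChartAt (cotangentModel E) z z) v w = v.2 w.1 := by
    intro v w
    rw [ModelWithCorners.range_eq_univ, fderivWithin_univ,
      (oneFormInChart_liouvilleForm_eventuallyEq z).fderiv_eq]
    exact fderiv_snd_comp_fst _ v w
  have : canonicalForm z v w = -(v.2 w.1 - w.2 v.1) := by
    rw [← hB v w, ← hB w v]; rfl
  rw [this, neg_sub]

end CanonicalForm

/-! ### Bilinear forms on subspaces -/

section LinearAlgebra

variable {V : Type*} [AddCommGroup V] [Module ℝ V] [FiniteDimensional ℝ V]

/-- A bilinear form that is nondegenerate on a subspace represents every linear functional there. -/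
theorem exists_mem_forall_apply_eq (B : V →ₗ[ℝ] V →ₗ[ℝ] ℝ) (K : Submodule ℝ V)
    (hB : ∀ v ∈ K, (∀ w ∈ K, B v w = 0) → v = 0) (f : V →ₗ[ℝ] ℝ) :
    ∃ v ∈ K, ∀ w ∈ K, B v w = f w := by
  let T : K →ₗ[ℝ] Module.Dual ℝ K := B.domRestrict₁₂ K K
  have hT : Function.Injective T := by
    refine (injective_iff_map_eq_zero T).2 fun v hv => ?_
    exact Subtype.ext (hB v v.2 fun w hw => LinearMap.congr_fun hv ⟨w, hw⟩)
  -- An injective map from `K` to its dual is surjective, by equality of dimensions.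
  obtain ⟨v, hv⟩ := (LinearMap.injective_iff_surjective_of_finrank_eq_finrank
    (Subspace.dual_finrank_eq (K := ℝ) (V := K)).symm).1 hT (f.domRestrict K)
  exact ⟨v, v.2, fun w hw => LinearMap.congr_fun hv ⟨w, hw⟩⟩

/-- A skew form is nondegenerate on `F ⊓ T` if `F` is coisotropic, `F` and `T` have the same
dimension, and `T` meets the orthogonal of `F` trivially. -/
theorem nondegenerate_on_inf_of_coisotropic (B : V →ₗ[ℝ] V →ₗ[ℝ] ℝ)
    (hskew : ∀ v w, B v w = -B w v) (hB : ∀ v, (∀ w, B v w = 0) → v = 0) (F T : Submodule ℝ V)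
    (hF : ∀ v, (∀ w ∈ F, B v w = 0) → v ∈ F) (hdim : Module.finrank ℝ T = Module.finrank ℝ F)
    (hT : ∀ v ∈ T, (∀ w ∈ F, B v w = 0) → v = 0) :
    ∀ v ∈ F ⊓ T, (∀ w ∈ F ⊓ T, B v w = 0) → v = 0 := by
  intro v hv h
  let b : LinearMap.BilinForm ℝ V := B
  have hmem : ∀ x, x ∈ b.orthogonal F ↔ ∀ w ∈ F, B x w = 0 := fun x =>
    forall₂_congr fun w _ => by
      change B w x = 0 ↔ _
      rw [hskew, neg_eq_zero]
  have hnd : b.Nondegenerate := by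
    refine ⟨fun x hx => hB x hx, fun x hx => hB x fun w => ?_⟩
    rw [hskew]; exact neg_eq_zero.2 (hx w)
  have hrank := b.finrank_orthogonal hnd F
  have hle := Submodule.finrank_le F
  have hbot : T ⊓ b.orthogonal F = ⊥ :=
    (Submodule.eq_bot_iff _).2 fun x hx => hT x hx.1 ((hmem x).1 hx.2)
  -- Since `dim F^⊥ = dim V - dim F` and `dim T = dim F`, the trivial intersection makes the sum all
  -- of `V`.
  have hsup : T ⊔ b.orthogonal F = ⊤ := by
    refine Submodule.eq_top_of_finrank_eq ?_
    have := Submodule.finrank_sup_add_finrank_inf_eq T (b.orthogonal F)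
    rw [hbot, finrank_bot] at this
    omega
  refine hT v hv.2 fun w hw => ?_
  -- Split `w ∈ F` as `t + o` with `o ∈ F^⊥ ⊆ F`. Then `t` lies in `F ⊓ T`, where `v` is orthogonal
  -- by assumption, and `o` is orthogonal to `v ∈ F`.
  obtain ⟨t, ht, o, ho, rfl⟩ := Submodule.mem_sup.1 (hsup ▸ Submodule.mem_top : w ∈ T ⊔ b.orthogonal F)
  have hoF := hF o ((hmem o).1 ho)
  have htF : t ∈ F := by simpa using F.sub_mem hw hoF
  rw [map_add, h t ⟨htF, ht⟩, hskew v o, (hmem o).1 ho v hv.1, neg_zero, add_zero]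

end LinearAlgebra

/-! ### Curves in the fibres of a submersion -/

section Submersion

open Filter Topology

/-- A vector in the kernel of the derivative of a submersion is the velocity of a curve in the
fibre. -/
theorem Manifold.IsSubmersionAt.exists_curve_of_mfderiv_eq_zero
    {E E' H H' M N : Type*} [NormedAddCommGroup E] [NormedSpace ℝ E] [NormedAddCommGroup E']
    [NormedSpace ℝ E'] [TopologicalSpace H] [TopologicalSpace H']
    {I : ModelWithCorners ℝ E H} {J : ModelWithCorners ℝ E' H'} [I.Boundaryless] [J.Boundaryless]
    [TopologicalSpace M] [ChartedSpace H M] [TopologicalSpace N] [ChartedSpace H' N]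
    [IsManifold I ∞ M] [IsManifold J ∞ N]
    {f : M → N} {x : M} (hf : IsSubmersionAt I J ∞ f x) (v : TangentSpace I x)
    (hv : mfderiv I J f x v = 0) :
    ∃ (c : ℝ → M) (c' : ℝ →L[ℝ] E), c 0 = x ∧ HasMFDerivAt 𝓘(ℝ, ℝ) I c 0 c' ∧ c' 1 = v ∧
      ∀ᶠ t in 𝓝 0, f (c t) = f x := by
  set φ := hf.domChart.extend I with hφ
  set ψ := hf.codChart.extend J with hψ
  have hxs : x ∈ hf.domChart.source := hf.mem_domChart_source
  have hxs' : x ∈ φ.source := by rwa [hφ, OpenPartialHomeomorph.extend_source]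
  have hys : f x ∈ hf.codChart.source := hf.mem_codChart_source
  have hφd : MDifferentiableAt I 𝓘(ℝ, E) φ x :=
    (hf.domChart.contMDiffAt_extend hf.domChart_mem_maximalAtlas hxs).mdifferentiableAt (by simp)
  have hψd : MDifferentiableAt J 𝓘(ℝ, E') ψ (f x) :=
    (hf.codChart.contMDiffAt_extend hf.codChart_mem_maximalAtlas hys).mdifferentiableAt (by simp)
  have hfd : MDifferentiableAt I J f x := hf.contMDiffAt.mdifferentiableAt (by simp)
  have htarget : φ.target ∈ 𝓝 (φ x) := by
    have := hf.domChart.extend_target_mem_nhdsWithin (I := I) hxs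
    rwa [ModelWithCorners.range_eq_univ, nhdsWithin_univ] at this
  have hsd : MDifferentiableAt 𝓘(ℝ, E) I φ.symm (φ x) := by
    have h := contMDiffOn_extend_symm hf.domChart_mem_maximalAtlas
    rw [← OpenPartialHomeomorph.extend_target'] at h
    exact (h.contMDiffAt htarget).mdifferentiableAt (by simp)
  have hmaps : ∀ y ∈ φ.target, φ.symm y ∈ hf.domChart.source := fun y hy => by
    rw [← OpenPartialHomeomorph.extend_source (I := I)]
    exact φ.map_target hy
  set A : E →L[ℝ] E := mfderiv I 𝓘(ℝ, E) φ x with hA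
  set B : E →L[ℝ] E := mfderiv 𝓘(ℝ, E) I φ.symm (φ x) with hB
  have hBA : B (A v) = v := by
    have h1 := HasMFDerivAt.comp x hsd.hasMFDerivAt hφd.hasMFDerivAt
    have hev : φ.symm ∘ φ =ᶠ[𝓝 x] id := by
      filter_upwards [hf.domChart.open_source.mem_nhds hxs] with y hy
      exact φ.left_inv (by rwa [hφ, OpenPartialHomeomorph.extend_source])
    have h2 := hev.mfderiv_eq (I := I) (I' := I)
    rw [h1.mfderiv, mfderiv_id] at h2
    exact DFunLike.congr_fun h2 v
  -- In adapted charts `f` is the projection to the first factor of `E' × complement`, so this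
  -- component is the derivative of `f` along `v`.
  have hfst : (hf.equiv (A v)).1 = 0 := by
    have h1 := HasMFDerivAt.comp x hψd.hasMFDerivAt hfd.hasMFDerivAt
    let p : E →L[ℝ] E' := (ContinuousLinearMap.fst ℝ E' hf.complement).comp
      (hf.equiv : E →L[ℝ] E' × hf.complement)
    have h2 := HasMFDerivAt.comp x (p.hasFDerivAt (x := φ x)).hasMFDerivAt hφd.hasMFDerivAt
    have hev : ψ ∘ f =ᶠ[𝓝 x] p ∘ φ := by
      filter_upwards [hf.domChart.open_source.mem_nhds hxs] with y hy
      have hy' : y ∈ φ.source := by rwa [hφ, OpenPartialHomeomorph.extend_source]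
      have := hf.writtenInCharts (φ.map_source hy')
      change ψ (f (φ.symm (φ y))) = _ at this
      rw [φ.left_inv hy'] at this
      exact this
    have h3 := hev.mfderiv_eq (I := I) (I' := 𝓘(ℝ, E'))
    rw [h1.mfderiv, h2.mfderiv] at h3
    have h4 := DFunLike.congr_fun h3 v
    change mfderiv J 𝓘(ℝ, E') ψ (f x) (mfderiv I J f x v) = p (A v) at h4
    rw [hv] at h4
    exact h4.symm.trans (map_zero (mfderiv J 𝓘(ℝ, E') ψ (f x)))
  -- The curve is the straight line in the adapted chart in the direction of `v`. It is meaningful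
  -- only while it stays in the chart target, which is why it is in the fibre only for small `t`.
  let l : ℝ → E := fun t => φ x + t • A v
  have hl0 : l 0 = φ x := by simp [l]
  have hl : HasFDerivAt l (ContinuousLinearMap.toSpanSingleton ℝ (A v)) 0 := by
    exact (ContinuousLinearMap.toSpanSingleton ℝ (A v)).hasFDerivAt.const_add (φ x)
  refine ⟨φ.symm ∘ l, B.comp (ContinuousLinearMap.toSpanSingleton ℝ (A v)), ?_, ?_, ?_, ?_⟩
  · rw [Function.comp_apply, hl0, φ.left_inv hxs']
  · refine HasMFDerivAt.comp 0 (g := φ.symm) (I' := 𝓘(ℝ, E)) (g' := B) ?_ hl.hasMFDerivAt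
    rw [hl0]
    exact hsd.hasMFDerivAt
  · simpa using hBA
  · have hmem : ∀ᶠ t in 𝓝 (0 : ℝ), l t ∈ φ.target :=
      hl.continuousAt.eventually_mem (hl0 ▸ htarget)
    filter_upwards [hmem] with t ht
    have h1 := hf.writtenInCharts ht
    have h2 := hf.writtenInCharts (φ.map_source hxs')
    change ψ (f (φ.symm (l t))) = (hf.equiv (φ x + t • A v)).1 at h1
    change ψ (f (φ.symm (φ x))) = (hf.equiv (φ x)).1 at h2
    rw [φ.left_inv hxs'] at h2
    rw [map_add, map_smul, Prod.fst_add, Prod.smul_fst, hfst, smul_zero, add_zero, ← h2] at h1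
    refine ψ.injOn ?_ ?_ h1
    · rw [hψ, OpenPartialHomeomorph.extend_source]
      exact hf.source_subset_preimage_source (hmaps _ ht)
    · rwa [hψ, OpenPartialHomeomorph.extend_source]

end Submersion

/-! ### The constraint distribution and the verticality of force and control terms -/

section Constraint

variable {E : Type*} [NormedAddCommGroup E] [NormedSpace ℝ E]
  {Q : Type*} [TopologicalSpace Q] [ChartedSpace E Q] [IsManifold 𝓘(ℝ, E) ∞ Q]

theorem contMDiff_tangentFiber (q : Q) :
    ContMDiff 𝓘(ℝ, E) 𝓘(ℝ, E).tangent ∞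
      (fun v : E => (⟨q, v⟩ : TangentBundle 𝓘(ℝ, E) Q)) := by
  intro v
  refine (Bundle.contMDiffAt_totalSpace (IB := 𝓘(ℝ, E))
    (f := fun v : E => (⟨q, v⟩ : TangentBundle 𝓘(ℝ, E) Q))).2 ⟨contMDiffAt_const, ?_⟩
  refine (contMDiffAt_id (I := 𝓘(ℝ, E)) (M := E)).congr_of_eventuallyEq (.of_forall fun w => ?_)
  exact tangentCoordChange_self (I := 𝓘(ℝ, E)) (mem_extChartAt_source q)

theorem tangentProj_verticalLift (z : CotangentBundle E Q) (β : CotangentSpace E Q z.proj) :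
    tangentProj z (verticalLift z β) = 0 := by
  rw [verticalLift_apply]
  exact tangentProj_apply z (0, β)

theorem canonicalForm_skew (z : CotangentBundle E Q) (v w : TangentSpace (cotangentModel E) z) :
    canonicalForm z v w = -canonicalForm z w v := by
  rw [canonicalForm_apply z v w, canonicalForm_apply z w v, neg_sub]

theorem canonicalForm_verticalLift (z : CotangentBundle E Q)
    (v : TangentSpace (cotangentModel E) z) (β : CotangentSpace E Q z.proj) :
    canonicalForm z v (verticalLift z β) =
      (show TangentSpace 𝓘(ℝ, E) (cotangentProj z) →L[ℝ] ℝ from β) (tangentProj z v) := by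
  rw [verticalLift_apply, tangentProj_apply z v]
  refine (canonicalForm_apply z v (0, β)).trans ?_
  rw [map_zero, sub_zero]
  rfl

/-- A vector orthogonal to all vertical vectors is vertical. -/
theorem tangentProj_eq_zero_of_canonicalForm [FiniteDimensional ℝ E] (z : CotangentBundle E Q)
    (v : TangentSpace (cotangentModel E) z)
    (h : ∀ β : CotangentSpace E Q z.proj, canonicalForm z v (verticalLift z β) = 0) :
    tangentProj z v = 0 := by
  have key : ∀ x : E, (∀ f : E →L[ℝ] ℝ, f x = 0) → x = 0 := fun x hx => by
    by_contra hne
    obtain ⟨f, hf⟩ := SeparatingDual.exists_ne_zero (R := ℝ) hne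
    exact hf (hx f)
  exact key _ fun f => (canonicalForm_verticalLift z v f).symm.trans (h f)

/-- Pairing with vertical vectors kills the base component; pairing with the vectors `(a, 0)` of the
chart then kills the fibre component. -/
theorem eq_zero_of_canonicalForm [FiniteDimensional ℝ E] (z : CotangentBundle E Q)
    (v : TangentSpace (cotangentModel E) z) (h : ∀ w, canonicalForm z v w = 0) : v = 0 := by
  have h1 : v.1 = 0 := (tangentProj_apply z v).symm.trans
    (tangentProj_eq_zero_of_canonicalForm z v fun β => h _)
  refine Prod.ext h1 (ContinuousLinearMap.ext fun a => ?_)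
  have h2 : v.2 a = 0 := by
    simpa using (canonicalForm_apply z v (a, 0)).symm.trans (h (a, 0))
  exact h2

namespace NonholonomicRCHSystem

variable (S : NonholonomicRCHSystem E Q)

theorem verticalLift_mem_distF (z : CotangentBundle E Q) (β : CotangentSpace E Q z.proj) :
    verticalLift z β ∈ S.distF z := by
  change tangentProj z _ ∈ S.D _
  rw [tangentProj_verticalLift]
  exact zero_mem _

/-- Replaces the equality in the tangent bundle that defines velocities by separate equalities of
base points and of vectors in the model space. -/
theorem mem_tangentM_of_curve {z : CotangentBundle E Q} (v : E × (E →L[ℝ] ℝ))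
    (c : ℝ → CotangentBundle E Q) (hc : ContMDiff 𝓘(ℝ, ℝ) (cotangentModel E) ∞ c)
    (hmem : ∀ t, c t ∈ S.constraintSet) (h0 : c 0 = z)
    (hv : (mfderiv 𝓘(ℝ, ℝ) (cotangentModel E) c 0 (1 : ℝ) : E × (E →L[ℝ] ℝ)) = v) :
    v ∈ S.tangentM z := by
  subst h0 hv
  exact Submodule.subset_span ⟨c, hc, hmem, rfl⟩

theorem contDiff_fiberDeriv (q : Q) : ContDiff ℝ ∞ (fiberDeriv S.L q : E → E →L[ℝ] ℝ) := by
  have h : ContMDiff 𝓘(ℝ, E) 𝓘(ℝ, ℝ) ∞ fun v : E => S.L ⟨q, v⟩ :=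
    S.smooth_L.comp (contMDiff_tangentFiber q)
  exact h.contDiff.fderiv_right (m := ∞) (by simp)

theorem contMDiff_legendre :
    ContMDiff 𝓘(ℝ, E).tangent (cotangentModel E) ∞ (legendre S.L) := by
  obtain ⟨Φ, hΦ⟩ := S.hyperregular
  exact (funext hΦ : ⇑Φ = legendre S.L) ▸ Φ.contMDiff

/-- The fibre Hessian of the Lagrangian maps `D` to vertical vectors tangent to `M`. -/
theorem hessian_mem_tangentM (q : Q) (v a : E) (hv : v ∈ S.D q) (ha : a ∈ S.D q) :
    ((0, fderiv ℝ (fiberDeriv S.L q) v a) : E × (E →L[ℝ] ℝ)) ∈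
      S.tangentM (legendre S.L ⟨q, v⟩) := by
  -- The line stays in the subspace `D_q`, so its Legendre image is a curve in `M` inside a single
  -- fibre of `T^*Q`.
  let l : ℝ → E := fun t => v + t • a
  have hl0 : l 0 = v := by simp [l]
  have hl : HasFDerivAt l (ContinuousLinearMap.toSpanSingleton ℝ a) 0 :=
    (ContinuousLinearMap.toSpanSingleton ℝ a).hasFDerivAt.const_add v
  have hlc : ContDiff ℝ ∞ l := by fun_prop
  refine S.mem_tangentM_of_curve _ (fun t => legendre S.L ⟨q, l t⟩)
    ((S.contMDiff_legendre.comp (contMDiff_tangentFiber q)).comp hlc.contMDiff)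
    (fun t => ⟨⟨q, l t⟩, (S.D q).add_mem hv ((S.D q).smul_mem t ha), rfl⟩) (by rw [hl0]) ?_
  have hd : HasFDerivAt (fiberDeriv S.L q) (fderiv ℝ (fiberDeriv S.L q) (l 0)) (l 0) :=
    ((S.contDiff_fiberDeriv q).differentiable (by simp) _).hasFDerivAt
  have h2 := HasMFDerivAt.comp (0 : ℝ) (hasMFDerivAt_cotangentFiber (legendre S.L ⟨q, l 0⟩))
    (hd.comp (0 : ℝ) hl).hasMFDerivAt
  refine (DFunLike.congr_fun h2.mfderiv (1 : ℝ)).trans ?_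
  rw [hl0]
  refine Prod.ext rfl ?_
  change fderiv ℝ (fiberDeriv S.L q) v ((1 : ℝ) • a) = _
  rw [one_smul]

variable [FiniteDimensional ℝ E]

/-- By regularity, every functional on `D_q` is represented by a vertical vector of `𝓚`. -/
theorem exists_verticalLift_mem_distK {z : CotangentBundle E Q} (hz : z ∈ S.constraintSet)
    (β : CotangentSpace E Q z.proj) :
    ∃ β' : CotangentSpace E Q z.proj, verticalLift z β' ∈ S.distK z ∧
      ∀ b ∈ S.D z.proj, β' b = β b := by
  obtain ⟨⟨q, v⟩, hv, rfl⟩ := hz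
  -- The fibre Hessian at `v`. Regularity makes it nondegenerate on `D_q`, so `β` restricted to
  -- `D_q` is the Hessian of some `a ∈ D_q`; the required covector is that Hessian functional.
  let B : E →ₗ[ℝ] E →ₗ[ℝ] ℝ :=
    (ContinuousLinearMap.coeLM ℝ).comp (fderiv ℝ (fiberDeriv S.L q) v).toLinearMap
  obtain ⟨a, ha, hab⟩ := exists_mem_forall_apply_eq B (S.D q)
    (fun a ha h => S.regular q v hv a ha h) (ContinuousLinearMap.toLinearMap (show E →L[ℝ] ℝ from β))
  exact ⟨fderiv ℝ (fiberDeriv S.L q) v a, ⟨S.verticalLift_mem_distF _ _,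
    Set.mem_of_eq_of_mem (verticalLift_apply _ _) (S.hessian_mem_tangentM q v a hv ha)⟩, hab⟩

variable {S}

/-- `𝓕` is coisotropic: it contains all vertical vectors, which are their own orthogonal, so a
vector orthogonal to `𝓕` is vertical and belongs to `𝓕`. Admissibility and compatibility supply the
remaining hypotheses of the linear lemma. -/
theorem IsAdmissible.nondegenerate_distK (hadm : S.IsAdmissible) {z : CotangentBundle E Q}
    (hz : z ∈ S.constraintSet) :
    ∀ v ∈ S.distK z, (∀ w ∈ S.distK z, canonicalForm z v w = 0) → v = 0 := by
  have : FiniteDimensional ℝ (TangentSpace (cotangentModel E) z) :=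
    inferInstanceAs (FiniteDimensional ℝ (E × (E →L[ℝ] ℝ)))
  refine nondegenerate_on_inf_of_coisotropic (canonicalForm z) (canonicalForm_skew z)
    (eq_zero_of_canonicalForm z) (S.distF z) (S.tangentM z) (fun v hv => ?_)
    (hadm.admissible z hz) (hadm.compatible z hz)
  change tangentProj z v ∈ S.D _
  rw [tangentProj_eq_zero_of_canonicalForm z v fun β => hv _ (S.verticalLift_mem_distF z β)]
  exact zero_mem _

theorem IsAdmissible.exists_mem_distK (hadm : S.IsAdmissible) {z : CotangentBundle E Q}
    (hz : z ∈ S.constraintSet) (f : TangentSpace (cotangentModel E) z →ₗ[ℝ] ℝ) :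
    ∃ x, x ∈ S.distK z ∧ ∀ w ∈ S.distK z, canonicalForm z x w = f w := by
  have : FiniteDimensional ℝ (TangentSpace (cotangentModel E) z) :=
    inferInstanceAs (FiniteDimensional ℝ (E × (E →L[ℝ] ℝ)))
  exact exists_mem_forall_apply_eq _ _ (hadm.nondegenerate_distK hz) f

/-- Nondegeneracy on `𝓚` provides a solution, so the choice made by `Classical.epsilon` is a genuine
one at points of `M`. -/
theorem IsAdmissible.fieldXK_spec (hadm : S.IsAdmissible) {z : CotangentBundle E Q}
    (hz : z ∈ S.constraintSet) :
    S.fieldXK z ∈ S.distK z ∧ ∀ w ∈ S.distK z,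
      canonicalForm z (S.fieldXK z) w = differential (cotangentModel E) S.H z w :=
  Classical.epsilon_spec (hadm.exists_mem_distK hz
    (mfderiv (cotangentModel E) 𝓘(ℝ, ℝ) S.H z).toLinearMap)

theorem IsAdmissible.tauK_spec (hadm : S.IsAdmissible) {z : CotangentBundle E Q}
    (hz : z ∈ S.constraintSet) (v : TangentSpace (cotangentModel E) z) :
    S.tauK z v ∈ S.distK z ∧ ∀ w ∈ S.distK z,
      canonicalForm z (S.tauK z v) w = canonicalForm z v w :=
  Classical.epsilon_spec (hadm.exists_mem_distK hz (canonicalForm z v))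

/-- The restriction to `𝓚` of a vertical vector is vertical. -/
theorem IsAdmissible.tangentProj_tauK_verticalLift (hadm : S.IsAdmissible)
    {z : CotangentBundle E Q} (hz : z ∈ S.constraintSet) (β : CotangentSpace E Q z.proj) :
    tangentProj z (S.tauK z (verticalLift z β)) = 0 := by
  obtain ⟨β', hβ', h⟩ := S.exists_verticalLift_mem_distK hz β
  obtain ⟨hmem, hspec⟩ := hadm.tauK_spec hz (verticalLift z β)
  have : S.tauK z (verticalLift z β) = verticalLift z β' := by
    -- Against `w ∈ 𝓚` both vectors pair through `Tπ_Q w ∈ D`, where `β` and `β'` agree.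
    refine sub_eq_zero.1 (hadm.nondegenerate_distK hz _ (sub_mem hmem hβ') fun w hw => ?_)
    rw [map_sub, LinearMap.sub_apply, hspec w hw, canonicalForm_skew z _ w,
      canonicalForm_skew z (verticalLift z β') w, canonicalForm_verticalLift,
      canonicalForm_verticalLift, sub_eq_zero]
    exact congrArg Neg.neg (h _ hw.1).symm
  rw [this, tangentProj_verticalLift]

/-- The force and the control do not change the projection to `TQ` of the dynamics. -/
theorem IsAdmissible.tangentProj_dynamicalField (hadm : S.IsAdmissible) (V : VerticalPart E Q)
    (u : FiberMap E Q) {z : CotangentBundle E Q} (hz : z ∈ S.constraintSet) :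
    tangentProj z (S.dynamicalField V u z) = tangentProj z (S.fieldXK z) := by
  -- Only the fact that both `vlift` fields are vertical lifts matters, so their covectors are left
  -- arbitrary.
  have h : ∀ β₁ β₂ : CotangentSpace E Q z.proj,
      tangentProj z (S.fieldXK z + S.tauK z (verticalLift z β₁) + S.tauK z (verticalLift z β₂)) =
        tangentProj z (S.fieldXK z) := fun β₁ β₂ => by
    rw [(tangentProj z).map_add, (tangentProj z).map_add, hadm.tangentProj_tauK_verticalLift hz,
      hadm.tangentProj_tauK_verticalLift hz, add_zero, add_zero]
  exact h _ _

end NonholonomicRCHSystem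

end Constraint

/-! ### Projection to the orbit space and lifting back along the one-form -/

section ReducedDynamics

open Filter Topology

variable {EG : Type*} [NormedAddCommGroup EG] [NormedSpace ℝ EG]
  {G : Type*} [TopologicalSpace G] [ChartedSpace EG G] [Group G]
  {E : Type*} [NormedAddCommGroup E] [NormedSpace ℝ E]
  {Q : Type*} [TopologicalSpace Q] [ChartedSpace E Q] [IsManifold 𝓘(ℝ, E) ∞ Q]
  [MulAction G Q] [ContMDiffSMul 𝓘(ℝ, EG) 𝓘(ℝ, E) ∞ G Q]
  {EP : Type*} [NormedAddCommGroup EP] [NormedSpace ℝ EP]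
  [ChartedSpace EP (OrbitSpace EG G E Q)]

/-- A vector tangent to an orbit is killed by the tangent map of the projection. -/
theorem tangentOrbitProj_of_mem_distV
    (hπ : MDifferentiable (cotangentModel E) 𝓘(ℝ, EP) (orbitProj EG G E Q))
    {z : CotangentBundle E Q} {v : TangentSpace (cotangentModel E) z}
    (hv : v ∈ NonholonomicRCHSystem.distV EG G z) :
    NonholonomicRCHSystem.tangentOrbitProj EG G EP z v = 0 := by
  refine (Submodule.span_le (p := (LinearMap.ker
    (NonholonomicRCHSystem.tangentOrbitProj EG G EP z).toLinearMap))).2 ?_ hv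
  rintro w ⟨ξ, hξ⟩
  change mfderiv (cotangentModel E) 𝓘(ℝ, EP) (orbitProj EG G E Q) z w = 0
  have hconst : (orbitProj EG G E Q) ∘ (fun g : G => cotangentLift g z) =
      fun _ => orbitProj EG G E Q z :=
    funext fun g => Quotient.sound ((orbitSetoid EG G E Q).symm ⟨g, rfl⟩)
  -- The velocity of the orbit map is based at `1 · z`, which is only propositionally `z`;
  -- quantifying over the point `p` of the tangent bundle avoids a transport.
  have key : ∀ p : TangentBundle (cotangentModel E) (CotangentBundle E Q),
      tangentMap 𝓘(ℝ, EG) (cotangentModel E) (fun g : G => cotangentLift g z) ⟨1, ξ⟩ = p →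
        mfderiv (cotangentModel E) 𝓘(ℝ, EP) (orbitProj EG G E Q) p.1 p.2 = 0 := by
    rintro _ rfl
    change mfderiv (cotangentModel E) 𝓘(ℝ, EP) (orbitProj EG G E Q) (cotangentLift (1 : G) z)
      (mfderiv 𝓘(ℝ, EG) (cotangentModel E) (fun g : G => cotangentLift g z) 1 ξ) = 0
    -- Without differentiability `mfderiv` is zero by convention and the generator is the zero
    -- vector, so smoothness of the lifted action need not be established.
    by_cases hd : MDifferentiableAt 𝓘(ℝ, EG) (cotangentModel E) (fun g : G => cotangentLift g z) 1
    · have h := mfderiv_comp (1 : G) (hπ _) hd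
      rw [hconst, mfderiv_const] at h
      exact (DFunLike.congr_fun h ξ).symm
    · rw [mfderiv_zero_of_not_mdifferentiableAt hd]
      exact map_zero (mfderiv (cotangentModel E) 𝓘(ℝ, EP) (orbitProj EG G E Q) _)
  exact key _ hξ

namespace NonholonomicRCHSystem

variable {S : NonholonomicRCHSystem E Q}

/-- The nonholonomic dynamical vector field is a lift of the reduced one. -/
theorem ReducedSystem.tangentOrbitProj_fieldXK [FiniteDimensional ℝ E] (hadm : S.IsAdmissible)
    (hπ : MDifferentiable (cotangentModel E) 𝓘(ℝ, EP) (orbitProj EG G E Q))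
    (R : S.ReducedSystem EG G EP) {z : CotangentBundle E Q} (hz : z ∈ S.constraintSet) :
    tangentOrbitProj EG G EP z (S.fieldXK z) = R.field (orbitProj EG G E Q z) := by
  obtain ⟨hmem, hspec⟩ := hadm.fieldXK_spec hz
  have hdiff : ∀ w, differential (cotangentModel E) S.H z w =
      differential 𝓘(ℝ, EP) R.h (orbitProj EG G E Q z) (tangentOrbitProj EG G EP z w) := by
    intro w
    have hH : S.H = R.h ∘ orbitProj EG G E Q := funext fun z => (R.h_orbitProj z).symm
    have h := mfderiv_comp z (R.smooth_h.mdifferentiable (by simp) _) (hπ z)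
    rw [← hH] at h
    exact DFunLike.congr_fun h w
  -- On `𝓥 ∩ 𝓚`, `ω(X_𝓚, v) = dH(v) = dh(Tπ_{/G} v) = 0`.
  have hU : S.fieldXK z ∈ S.distU EG G z := by
    refine ⟨hmem, fun v hv => ?_⟩
    rw [hspec v hv.2, hdiff, tangentOrbitProj_of_mem_distV hπ hv.1]
    exact map_zero (mfderiv 𝓘(ℝ, EP) 𝓘(ℝ, ℝ) R.h (orbitProj EG G E Q z))
  have hU' : tangentOrbitProj EG G EP z (S.fieldXK z) ∈ S.distKbar EG G EP z :=
    ⟨_, hU, rfl⟩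
  refine sub_eq_zero.1 (R.nondegenerate_form z hz _ (sub_mem hU' (R.field_mem z hz)) ?_)
  intro b hb
  rw [map_sub, LinearMap.sub_apply, R.hamilton z hz b hb, sub_eq_zero]
  obtain ⟨w, hw, rfl⟩ := hb
  exact (R.pullback_form z hz _ hU w hw).trans ((hspec w hw.1).trans (hdiff w))

end NonholonomicRCHSystem

/-- Along an equivariant one-form, a vector tangent to the fibre of `π_{/G}` is tangent to the image
of the one-form. -/
theorem mfderiv_oneFormMap_tangentProj_of_orbitProj_eq_zero [FiniteDimensional ℝ E]
    [IsManifold 𝓘(ℝ, EP) ∞ (OrbitSpace EG G E Q)]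
    (hsubm : Manifold.IsSubmersion (cotangentModel E) 𝓘(ℝ, EP) ∞ (orbitProj EG G E Q))
    {γ : ∀ q : Q, CotangentSpace E Q q}
    (hγ : MDifferentiable 𝓘(ℝ, E) (cotangentModel E) (oneFormMap γ))
    (hγG : ∀ (g : G) (q : Q), cotangentLift g (oneFormMap γ q) = oneFormMap γ (g • q))
    (q : Q) (d : TangentSpace (cotangentModel E) (oneFormMap γ q))
    (hd : NonholonomicRCHSystem.tangentOrbitProj EG G EP (oneFormMap γ q) d = 0) :
    mfderiv 𝓘(ℝ, E) (cotangentModel E) (oneFormMap γ) q (tangentProj (oneFormMap γ q) d) = d := by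
  obtain ⟨c, c', hc0, hc, hc1, hfib⟩ :=
    (hsubm.isSubmersionAt (oneFormMap γ q)).exists_curve_of_mfderiv_eq_zero d hd
  -- For small `t` the point `c t` is on the orbit of `γ(q)`, so `c t = g · γ(q) = γ(g q)` lies in
  -- the image of `γ`, which `γ ∘ π_Q` fixes pointwise. Differentiating at `0` gives the claim.
  have hev : (oneFormMap γ ∘ cotangentProj) ∘ c =ᶠ[𝓝 0] c := by
    filter_upwards [hfib] with t ht
    obtain ⟨g, hg⟩ := Quotient.exact ht.symm
    change oneFormMap γ (c t).proj = c t
    rw [← hg, hγG]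
    rfl
  let L : E × (E →L[ℝ] ℝ) →L[ℝ] E × (E →L[ℝ] ℝ) :=
    (mfderiv 𝓘(ℝ, E) (cotangentModel E) (oneFormMap γ) q).comp (tangentProj (oneFormMap γ q))
  have h1 : HasMFDerivAt (cotangentModel E) (cotangentModel E) (oneFormMap γ ∘ cotangentProj)
      (oneFormMap γ q) L :=
    HasMFDerivAt.comp _ (hγ q).hasMFDerivAt (mdifferentiable_cotangentProj _).hasMFDerivAt
  rw [← hc0] at h1
  have h2 : HasMFDerivAt 𝓘(ℝ, ℝ) (cotangentModel E) c 0 (L.comp c') :=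
    (HasMFDerivAt.comp 0 h1 hc).congr_of_eventuallyEq hev.symm
  have h3 : L (c' 1) = c' 1 := DFunLike.congr_fun (hasMFDerivAt_unique h2 hc) (1 : ℝ)
  rw [hc1] at h3
  exact h3

/-- If the values at `p` of the equations agree after projection to the orbit space, they agree
already in the tangent bundle of `T^* Q`. -/
theorem tangentMap_oneFormMap_eq_iff [FiniteDimensional ℝ E]
    [IsManifold 𝓘(ℝ, EP) ∞ (OrbitSpace EG G E Q)]
    (hsubm : Manifold.IsSubmersion (cotangentModel E) 𝓘(ℝ, EP) ∞ (orbitProj EG G E Q))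
    {γ : ∀ q : Q, CotangentSpace E Q q}
    (hγ : MDifferentiable 𝓘(ℝ, E) (cotangentModel E) (oneFormMap γ))
    (hγG : ∀ (g : G) (q : Q), cotangentLift g (oneFormMap γ q) = oneFormMap γ (g • q))
    (p : CotangentBundle E Q) (x : TangentSpace (cotangentModel E) p) :
    tangentMap 𝓘(ℝ, E) (cotangentModel E) (oneFormMap γ) ⟨p.proj, tangentProj p x⟩ = ⟨p, x⟩ ↔
      tangentMap 𝓘(ℝ, E) 𝓘(ℝ, EP) (orbitProj EG G E Q ∘ oneFormMap γ) ⟨p.proj, tangentProj p x⟩ =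
        ⟨orbitProj EG G E Q p, NonholonomicRCHSystem.tangentOrbitProj EG G EP p x⟩ := by
  have hπ : MDifferentiable (cotangentModel E) 𝓘(ℝ, EP) (orbitProj EG G E Q) :=
    hsubm.contMDiff.mdifferentiable (by simp)
  rw [tangentMap_comp_at _ (hπ _) (hγ _)]
  refine ⟨fun h => by rw [h]; rfl, fun h => ?_⟩
  obtain ⟨g, hg⟩ := Quotient.exact (congrArg TotalSpace.proj h)
  -- With `q = π_Q(p)`, being on one orbit gives `p = g · γ(q) = γ(g q)`; projecting to `Q` yields
  -- `g q = q`, hence `p = γ(q)`.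
  have hp : oneFormMap γ p.proj = p := by
    have hg : oneFormMap γ (g • p.proj) = p := (hγG g p.proj).symm.trans hg
    have hq : g • p.proj = p.proj := congrArg TotalSpace.proj hg
    rwa [hq] at hg
  -- A free `q` allows `p` to be replaced by `γ(q)`, so that both tangent vectors live in the same
  -- tangent space and can be subtracted.
  have key : ∀ q, oneFormMap γ q = p → tangentMap (cotangentModel E) 𝓘(ℝ, EP) (orbitProj EG G E Q)
      (tangentMap 𝓘(ℝ, E) (cotangentModel E) (oneFormMap γ) ⟨p.proj, tangentProj p x⟩) =
        ⟨orbitProj EG G E Q p, NonholonomicRCHSystem.tangentOrbitProj EG G EP p x⟩ →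
      tangentMap 𝓘(ℝ, E) (cotangentModel E) (oneFormMap γ) ⟨p.proj, tangentProj p x⟩ = ⟨p, x⟩ := by
    rintro q rfl h
    set y : TangentSpace (cotangentModel E) (oneFormMap γ q) :=
      mfderiv 𝓘(ℝ, E) (cotangentModel E) (oneFormMap γ) q (tangentProj (oneFormMap γ q) x) with hy
    have h1 : NonholonomicRCHSystem.tangentOrbitProj EG G EP (oneFormMap γ q) y =
        NonholonomicRCHSystem.tangentOrbitProj EG G EP (oneFormMap γ q) x :=
      eq_of_heq (TotalSpace.mk.inj h).2
    have h2 : tangentProj (oneFormMap γ q) y = tangentProj (oneFormMap γ q) x := by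
      have hid : cotangentProj ∘ oneFormMap γ = id := rfl
      have h := mfderiv_comp q (mdifferentiable_cotangentProj (oneFormMap γ q)) (hγ q)
      rw [hid, mfderiv_id] at h
      exact (DFunLike.congr_fun h (tangentProj (oneFormMap γ q) x)).symm
    -- The difference is recovered by `Tγ` from its projection to `TQ`, and that projection is zero.
    have h3 := mfderiv_oneFormMap_tangentProj_of_orbitProj_eq_zero hsubm hγ hγG q (y - x)
      (by rw [ContinuousLinearMap.map_sub, h1, sub_self])
    rw [ContinuousLinearMap.map_sub, h2, sub_self] at h3
    have h4 : y - x = 0 :=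
      h3.symm.trans (map_zero (mfderiv 𝓘(ℝ, E) (cotangentModel E) (oneFormMap γ) q))
    exact congrArg (TotalSpace.mk (oneFormMap γ q)) (sub_eq_zero.1 h4)
  exact key _ hp h

end ReducedDynamics

/-! ### The equivalence of the two Hamilton–Jacobi equations -/

theorem theorem4p4
    {E : Type*} [NormedAddCommGroup E] [NormedSpace ℝ E] [FiniteDimensional ℝ E]
    {Q : Type*} [TopologicalSpace Q] [T2Space Q] [SecondCountableTopology Q] [ChartedSpace E Q]
    [IsManifold 𝓘(ℝ, E) ∞ Q]
    {EG : Type*} [NormedAddCommGroup EG] [NormedSpace ℝ EG] [FiniteDimensional ℝ EG]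
    {G : Type*} [TopologicalSpace G] [T2Space G] [SecondCountableTopology G] [ChartedSpace EG G]
    [Group G] [LieGroup 𝓘(ℝ, EG) ∞ G]
    [MulAction G Q] [ContMDiffSMul 𝓘(ℝ, EG) 𝓘(ℝ, E) ∞ G Q]
    -- the quotient manifold `T^* Q / G`, for which the projection is a submersion
    {EP : Type*} [NormedAddCommGroup EP] [NormedSpace ℝ EP] [FiniteDimensional ℝ EP]
    [ChartedSpace EP (OrbitSpace EG G E Q)] [IsManifold 𝓘(ℝ, EP) ∞ (OrbitSpace EG G E Q)]
    (hsubm : Manifold.IsSubmersion (cotangentModel E) 𝓘(ℝ, EP) ∞ (orbitProj EG G E Q))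
    -- the nonholonomic reducible RCH system with symmetry, and its control law `u`
    (S : NonholonomicRCHSystem E Q) (hsymm : S.IsSymmetric G) (hadm : S.IsAdmissible)
    (V : VerticalPart E Q)
    (u : FiberMap E Q) (hu : ∀ z, u.total z ∈ S.W)
    (R : S.ReducedSystem EG G EP)
    -- the one-form `γ`
    (γ : ∀ q : Q, CotangentSpace E Q q)
    (hγ : ContMDiff 𝓘(ℝ, E) (cotangentModel E) ∞ (oneFormMap γ))
    (hγM : ∀ q, oneFormMap γ q ∈ S.constraintSet)
    (hγG : ∀ (g : G) (q : Q), cotangentLift g (oneFormMap γ q) = oneFormMap γ (g • q))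
    (hγK : ∀ q, ∀ v ∈ S.D q,
      mfderiv 𝓘(ℝ, E) (cotangentModel E) (oneFormMap γ) q v ∈ S.distK (oneFormMap γ q))
    -- the symplectic map `ε`
    (ε : CotangentBundle E Q → CotangentBundle E Q) (hε : IsSymplecticMap ε)
    (hεG : ∀ (g : G) (z : CotangentBundle E Q), ε (cotangentLift g z) = cotangentLift g (ε z))
    (hεM : ∀ z ∈ S.constraintSet, ε z ∈ S.constraintSet) :
    (∀ z ∈ S.constraintSet, S.TypeIIAt V u γ ε z ↔ R.TypeIIAt V u γ ε z) ∧
      ((∀ z ∈ S.constraintSet, S.TypeIIAt V u γ ε z) ↔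
        ∀ z ∈ S.constraintSet, R.TypeIIAt V u γ ε z) := by
  have hπ : MDifferentiable (cotangentModel E) 𝓘(ℝ, EP) (orbitProj EG G E Q) :=
    hsubm.contMDiff.mdifferentiable (by simp)
  have key : ∀ z ∈ S.constraintSet, S.TypeIIAt V u γ ε z ↔ R.TypeIIAt V u γ ε z := by
    intro z hz
    have hzM := hεM z hz
    have hfield : S.fieldEps V u ε z = ⟨(ε z).proj, tangentProj (ε z) (S.fieldXK (ε z))⟩ :=
      congrArg (TotalSpace.mk (ε z).proj) (hadm.tangentProj_dynamicalField V u hzM)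
    rw [NonholonomicRCHSystem.TypeIIAt, NonholonomicRCHSystem.ReducedSystem.TypeIIAt, hfield,
      ← R.tangentOrbitProj_fieldXK hadm hπ hzM]
    exact tangentMap_oneFormMap_eq_iff hsubm (hγ.mdifferentiable (by simp)) hγG (ε z) _
  exact ⟨key, forall₂_congr key⟩
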